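/- Let $X=(X_t)_{t\ge 0}$ be a real-valued Lévy process (that is, $X_0=0$ almost surely, $X$ has independent and stationary increments, and its paths are almost surely càdlàg) with zero mean and finite, non-zero variance: $\mathbb{E}[X_1]=0$ and $0<\mathrm{Var}(X_1)<\infty$. Write $\underline{X}_t:=\inf_{0\le s\le t}X_s$. Then $$\limsup_{t\to\infty}\; t^{1/2}\,\sup_{u\ge 0}\,\frac{1}{u+1}\,\mathbb{P}\big(\underline{X}_t\ge -u\big)<\infty .$$ -/

import Mathlib

open MeasureTheory ProbabilityTheory Filter Topology
open scoped NNReal ENNReal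

/-- A path `x : [0, ∞) → ℝ` is càdlàg: right-continuous with finite left limits.
(At `t = 0` the left-limit condition is void, since `𝓝[<] (0 : ℝ≥0) = ⊥`.) -/
def IsCadlagPath (x : ℝ≥0 → ℝ) : Prop :=
  ∀ t : ℝ≥0, ContinuousWithinAt x (Set.Ici t) t ∧ ∃ l : ℝ, Tendsto x (𝓝[<] t) (𝓝 l)

/-- A real-valued Lévy process `(X_t)_{t ≥ 0}` on the probability space `(Ω, μ)`: it starts at zero,
has independent and stationary increments, and has càdlàg paths, almost surely. -/
structure IsLevyProcess {Ω : Type*} [MeasurableSpace Ω] (X : ℝ≥0 → Ω → ℝ) (μ : Measure Ω) :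
    Prop where
  measurable : ∀ t : ℝ≥0, Measurable (X t)
  zero_ae : ∀ᵐ ω ∂μ, X 0 ω = 0
  indep_increments : HasIndepIncrements X μ
  stationary_increments : ∀ s h : ℝ≥0,
    IdentDistrib (fun ω => X (s + h) ω - X s ω) (X h) μ μ
  cadlag_ae : ∀ᵐ ω ∂μ, IsCadlagPath (fun t => X t ω)

/-- The running infimum `inf_{0 ≤ s ≤ t} X_s`, taken in the extended reals so that it is the true
infimum for every path. -/
noncomputable def runningInf {Ω : Type*} (X : ℝ≥0 → Ω → ℝ) (t : ℝ≥0) (ω : Ω) : EReal :=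
  ⨅ s ∈ Set.Icc 0 t, (X s ω : EReal)

/-! If the infimum stays above `-u` up to time `t`, so does the walk `S` of integer-time values,
whose steps are iid, centred and of finite non-zero variance. It is therefore enough to bound by a
multiple of `(u + 1) / √n` the probability that `u + S` survives in `[0, ∞)` up to time `n`.

Surviving is an increasing event in the steps, so by positive association (`killedWalk_one_mul_le`)
`P(survive) * E[(u + S_n)⁺] ≤ E[(u + S_n)⁺; survive]`. The right side is at most `V u ≤ 2 * u + 2 *
R`, where `V` dominates the identity on the half-line and is superharmonic for the killed walk
(`exists_superharmonic`). On the left, `E[(u + S_n)⁺] ≥ E[S_n⁺] = E|S_n| / 2`, which is of order at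
least `√n` by convergence of characteristic functions (`exists_mul_sqrt_le_integral_abs_sum`).
Dividing gives the bound, uniformly in `u`. -/

/-! ### A superharmonic function of linear growth -/

/-- A centred law with positive variance charges a bounded window of negative values. -/
lemma exists_setIntegral_sq_Ico_pos {ν : Measure ℝ} [IsProbabilityMeasure ν]
    (h2 : MemLp id 2 ν) (h0 : ∫ x, x ∂ν = 0) (hv : 0 < ∫ x, x ^ 2 ∂ν) :
    ∃ L : ℝ, 0 ≤ L ∧ 0 < ∫ x in Set.Ico (-L) 0, x ^ 2 ∂ν := by
  have hsq : Integrable (fun x : ℝ => x ^ 2) ν := h2.integrable_sq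
  have h1 : Integrable (fun x : ℝ => x) ν := h2.integrable one_le_two
  by_contra! hcon
  have hz : ∀ n : ℕ, ν (Set.Ico (-(n : ℝ)) 0) = 0 := by
    intro n
    by_contra hne
    have hpos : 0 < ∫ x in Set.Ico (-(n : ℝ)) 0, x ^ 2 ∂ν := by
      rw [setIntegral_pos_iff_support_of_nonneg_ae
        (Eventually.of_forall fun x => sq_nonneg x) hsq.integrableOn]
      refine lt_of_lt_of_le (pos_iff_ne_zero.2 hne) (measure_mono fun x hx => ⟨?_, hx⟩)
      simpa using hx.2.ne
    exact absurd hpos (not_lt.2 (hcon n n.cast_nonneg))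
  have hneg : ν (Set.Iio 0) = 0 := by
    refine measure_mono_null (fun x hx => ?_) (measure_iUnion_null hz)
    obtain ⟨n, hn⟩ := exists_nat_ge (-x)
    exact Set.mem_iUnion.2 ⟨n, by constructor <;> [linarith; exact hx]⟩
  have hnn : 0 ≤ᵐ[ν] fun x : ℝ => x := by
    rw [Filter.EventuallyLE, ae_iff]
    simpa [Set.Iio] using hneg
  have hae := (integral_eq_zero_iff_of_nonneg_ae hnn h1).1 h0
  have : ∫ x, x ^ 2 ∂ν = 0 := by
    refine integral_eq_zero_of_ae ?_
    filter_upwards [hae] with x hx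
    simp_all
  linarith

/-- Truncated second moments vanish in the limit. -/
lemma tendsto_integral_sq_max_neg_sub {ν : Measure ℝ} (hsq : Integrable (fun x : ℝ => x ^ 2) ν) :
    Tendsto (fun n : ℕ => ∫ y, (max (-y - n) 0) ^ 2 ∂ν) atTop (𝓝 0) := by
  have hbd : ∀ (n : ℕ) (y : ℝ), ‖(max (-y - n) 0) ^ 2‖ ≤ y ^ 2 := by
    intro n y
    have hn : (0 : ℝ) ≤ n := n.cast_nonneg
    rw [Real.norm_of_nonneg (sq_nonneg _)]
    rcases le_total (-y - n) 0 with h | h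
    · rw [max_eq_right h]; simpa using sq_nonneg y
    · rw [max_eq_left h]; nlinarith
  have := tendsto_integral_of_dominated_convergence (μ := ν)
    (F := fun (n : ℕ) (y : ℝ) => (max (-y - n) 0) ^ 2) (f := fun _ => 0) (fun y => y ^ 2)
    (fun n => by fun_prop) hsq (fun n => Eventually.of_forall (hbd n))
    (Eventually.of_forall fun y => ?_)
  · simpa using this
  · obtain ⟨N, hN⟩ := exists_nat_ge (-y)
    refine tendsto_const_nhds.congr' ?_
    filter_upwards [eventually_ge_atTop N] with n hn
    have : (N : ℝ) ≤ n := by exact_mod_cast hn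
    rw [max_eq_right (by linarith)]
    simp

/-- Tangent-line inequality at `a - x` for the convex function `z ↦ (z⁺)²`. -/
lemma sq_max_sub_sub_sq_max_sub_ge (a : ℝ) {x y : ℝ} (h : y ≤ x) :
    2 * (x - y) * max (a - x) 0 ≤ (max (a - y) 0) ^ 2 - (max (a - x) 0) ^ 2 := by
  rcases le_total (a - x) 0 with h1 | h1
  · rw [max_eq_right h1]
    nlinarith [sq_nonneg (max (a - y) 0)]
  · rw [max_eq_left h1, max_eq_left (by linarith : 0 ≤ a - y)]
    nlinarith

/-- Primitive of a nonnegative antitone function that drops at least at rate `k` to the left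
of `x`: a quantitative concavity estimate. -/
lemma integral_antitone_sub_le {D : ℝ → ℝ} (hD : Antitone D) {x L k : ℝ}
    (hk : ∀ y, x - L ≤ y → y ≤ x → D x + k * (x - y) ≤ D y) (t : ℝ) :
    (∫ y in (0 : ℝ)..(x + t), D y) ≤
      (∫ y in (0 : ℝ)..x, D y) + D x * t - k / 2 * (Set.Ico (-L) 0).indicator (fun t => t ^ 2) t := by
  have hint : ∀ a b, IntervalIntegrable D volume a b := fun a b => hD.intervalIntegrable
  have hsub := intervalIntegral.integral_interval_sub_left (hint 0 (x + t)) (hint 0 x)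
  by_cases ht : t ∈ Set.Ico (-L) 0
  · rw [Set.indicator_of_mem ht]
    have h1 : (∫ y in (x + t)..x, (D x + k * (x - y))) ≤ ∫ y in (x + t)..x, D y := by
      refine intervalIntegral.integral_mono_on (by linarith [ht.2])
        (Continuous.intervalIntegrable (by fun_prop) _ _) (hint _ _) fun y hy => ?_
      exact hk y (by linarith [hy.1, ht.1]) hy.2
    have h2 : (∫ y in (x + t)..x, (D x + k * (x - y))) = D x * (-t) + k / 2 * t ^ 2 := by
      rw [intervalIntegral.integral_add (by simp) (Continuous.intervalIntegrable (by fun_prop) _ _),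
        intervalIntegral.integral_const_mul, intervalIntegral.integral_sub (by simp) (by simp)]
      simp
      ring
    rw [intervalIntegral.integral_symm (x + t) x] at hsub
    linarith
  · rw [Set.indicator_of_notMem ht]
    rcases le_total 0 t with h0 | h0
    · have h1 : (∫ y in x..(x + t), D y) ≤ ∫ y in x..(x + t), D x :=
        intervalIntegral.integral_mono_on (by linarith) (hint _ _) (by simp)
          fun y hy => hD hy.1
      simp at h1
      linarith
    · have h1 : (∫ y in (x + t)..x, D x) ≤ ∫ y in (x + t)..x, D y :=
        intervalIntegral.integral_mono_on (by linarith) (by simp) (hint _ _)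
          fun y hy => hD hy.2
      simp at h1
      rw [intervalIntegral.integral_symm (x + t) x] at hsub
      linarith

/-- For a centred square-integrable law there is a nonnegative function of linear growth on the
half-line which is superharmonic for the random walk killed on leaving `[0, ∞)`. -/
lemma exists_superharmonic {ν : Measure ℝ} [IsProbabilityMeasure ν]
    (h2 : MemLp id 2 ν) (h0 : ∫ x, x ∂ν = 0) (hv : 0 < ∫ x, x ^ 2 ∂ν) :
    ∃ (R : ℝ) (V : ℝ → ℝ≥0∞), 0 ≤ R ∧ (∀ x, 0 ≤ x → ENNReal.ofReal x ≤ V x) ∧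
      (∀ x, 0 ≤ x → V x ≤ ENNReal.ofReal (2 * x + 2 * R)) ∧
      ∀ x, 0 ≤ x → ∫⁻ y, V (x + y) ∂ν ≤ V x := by
  have hsq : Integrable (fun x : ℝ => x ^ 2) ν := h2.integrable_sq
  have h1 : Integrable (fun x : ℝ => x) ν := h2.integrable one_le_two
  obtain ⟨L, hL, hs⟩ := exists_setIntegral_sq_Ico_pos h2 h0 hv
  set s := ∫ x in Set.Ico (-L) 0, x ^ 2 ∂ν with hsdef
  obtain ⟨n, hn⟩ := ((tendsto_integral_sq_max_neg_sub hsq).eventually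
    (gt_mem_nhds (by positivity : 0 < s / 2))).exists
  -- For arguments at least `-L`, the shift by `R` is at least `n`, so the truncated second moment
  -- stays below `s / 2`.
  set R : ℝ := n + L with hR
  have hn0 : (0 : ℝ) ≤ n := n.cast_nonneg
  have hR0 : 0 ≤ R := by positivity
  have hIsq : ∀ c : ℝ, Integrable (fun y : ℝ => (max (-y - c) 0) ^ 2) ν := fun c => by
    have hm : MemLp (fun y : ℝ => -y - c) 2 ν := h2.neg.sub (memLp_const c)
    exact MemLp.integrable_sq (f := fun y : ℝ => max (-y - c) 0) hm.pos_part
  have hI1 : ∀ c : ℝ, Integrable (fun y : ℝ => max (-y - c) 0) ν := fun c =>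
    (h1.neg.sub (integrable_const c)).pos_part
  -- On `[-L, ∞)` the derivative of `D` is formally `-2 * s⁻¹ * H`. Freezing `D` below `-L` keeps it
  -- at most `1 / 2`.
  let D : ℝ → ℝ := fun x => s⁻¹ * ∫ y, (max (-y - (R + max x (-L))) 0) ^ 2 ∂ν
  let H : ℝ → ℝ := fun x => ∫ y, max (-y - (R + x)) 0 ∂ν
  have hDH : ∀ x y, y ≤ x → -L ≤ y → D x + 2 * s⁻¹ * H x * (x - y) ≤ D y := by
    intro x y hyx hy
    have : ∫ z, 2 * (x - y) * max (-z - (R + x)) 0 ∂ν ≤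
        ∫ z, ((max (-z - (R + y)) 0) ^ 2 - (max (-z - (R + x)) 0) ^ 2) ∂ν := by
      refine integral_mono ((hI1 _).const_mul _) ((hIsq _).sub (hIsq _)) fun z => ?_
      have := sq_max_sub_sub_sq_max_sub_ge (-z) (add_le_add_right hyx R)
      simpa using this
    rw [integral_const_mul, integral_sub (hIsq _) (hIsq _)] at this
    simp only [D, H, max_eq_left hy, max_eq_left (hy.trans hyx)]
    have h3 := mul_le_mul_of_nonneg_left this (inv_pos.2 hs).le
    linarith
  have hDanti : Antitone D := by
    intro x y hxy
    refine mul_le_mul_of_nonneg_left (integral_mono (hIsq _) (hIsq _) fun z => ?_)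
      (inv_pos.2 hs).le
    have : max x (-L) ≤ max y (-L) := max_le_max_right _ hxy
    dsimp only
    gcongr
  have hD0 : ∀ x, 0 ≤ D x := fun x =>
    mul_nonneg (inv_pos.2 hs).le (integral_nonneg fun y => sq_nonneg _)
  have hD1 : ∀ x, D x ≤ 1 / 2 := by
    intro x
    have : ∫ y, (max (-y - (R + max x (-L))) 0) ^ 2 ∂ν ≤ s / 2 := by
      refine (integral_mono (hIsq _) (hIsq n) fun z => ?_).trans hn.le
      have : -L ≤ max x (-L) := le_max_right _ _
      dsimp only
      gcongr
      linarith
    calc D x ≤ s⁻¹ * (s / 2) := mul_le_mul_of_nonneg_left this (inv_pos.2 hs).le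
      _ = 1 / 2 := by field_simp
  have hint : ∀ a b, IntervalIntegrable D volume a b := fun a b => hDanti.intervalIntegrable
  let φ : ℝ → ℝ := fun x => ∫ y in (0 : ℝ)..x, D y
  have hφcont : Continuous φ := intervalIntegral.continuous_primitive hint 0
  have hφabs : ∀ x, |φ x| ≤ 1 / 2 * |x| := by
    intro x
    have := intervalIntegral.norm_integral_le_of_norm_le_const (a := 0) (b := x) (f := D)
      (C := 1 / 2) fun y _ => by rw [Real.norm_of_nonneg (hD0 y)]; exact hD1 y
    simpa using this
  have hφ0 : ∀ x, 0 ≤ x → 0 ≤ φ x := fun x hx =>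
    intervalIntegral.integral_nonneg hx fun y _ => hD0 y
  have hφint : ∀ x, Integrable (fun y => φ (x + y)) ν := by
    intro x
    refine Integrable.mono' (((integrable_const x).add h1).abs.const_mul (1 / 2))
      (by fun_prop) (Eventually.of_forall fun y => hφabs (x + y))
  have hind : Integrable ((Set.Ico (-L) 0).indicator fun t : ℝ => t ^ 2) ν :=
    hsq.indicator measurableSet_Ico
  have hφsup : ∀ x, 0 ≤ x → ∫ y, φ (x + y) ∂ν ≤ φ x - H x := by
    intro x hx
    -- The linear term integrates to zero by centring, and the quadratic one to `(2 * s⁻¹ * H x) / 2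
    -- * s = H x`.
    have hpt : ∀ t, φ (x + t) ≤ φ x + D x * t -
        (2 * s⁻¹ * H x) / 2 * (Set.Ico (-L) 0).indicator (fun t => t ^ 2) t :=
      integral_antitone_sub_le hDanti fun y hy hyx => hDH x y hyx (by linarith)
    have hi1 : Integrable (fun t => φ x + D x * t) ν := (integrable_const _).add (h1.const_mul _)
    refine (integral_mono (hφint x) (hi1.sub (hind.const_mul _)) hpt).trans_eq ?_
    rw [integral_sub' hi1 (hind.const_mul _), integral_add (integrable_const _) (h1.const_mul _),
      integral_const_mul, integral_const_mul, h0, integral_indicator measurableSet_Ico, ← hsdef]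
    simp
    field_simp
  have habs : ∀ x, ∫ y, |x + y + R| ∂ν = x + R + 2 * H x := by
    intro x
    have : ∀ y, |x + y + R| = (x + R + y) + 2 * max (-y - (R + x)) 0 := by
      intro y
      rcases le_total 0 (x + y + R) with h | h
      · rw [abs_of_nonneg h, max_eq_right (by linarith)]; ring
      · rw [abs_of_nonpos h, max_eq_left (by linarith)]; ring
    simp_rw [this]
    have hi : Integrable (fun y => x + R + y) ν := (integrable_const _).add h1
    rw [integral_add hi ((hI1 _).const_mul _), integral_add (integrable_const _) h1,
      integral_const_mul, h0]
    simp [H]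
  -- Averaging `|x + R|` over a step costs `2 * H x`, the overshoot below `-R`; `2 * φ` repays
  -- exactly that. The constant `R` keeps `W` nonnegative at negative arguments, where `2 * φ x ≥
  -- -|x|`.
  let W : ℝ → ℝ := fun x => |x + R| + R + 2 * φ x
  have hW0 : ∀ x, 0 ≤ W x := by
    intro x
    have := abs_le.1 (hφabs x)
    simp only [W]
    rcases le_total 0 x with h | h
    · have := hφ0 x h
      positivity
    · rw [abs_of_nonpos h] at this
      rcases le_total 0 (x + R) with h' | h'
      · rw [abs_of_nonneg h']; linarith
      · rw [abs_of_nonpos h']; linarith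
  refine ⟨R, fun x => ENNReal.ofReal (W x), hR0, fun x hx => ENNReal.ofReal_le_ofReal ?_,
    fun x hx => ENNReal.ofReal_le_ofReal ?_, fun x hx => ?_⟩
  · have := hφ0 x hx
    simp only [W]
    rw [abs_of_nonneg (by linarith)]
    linarith
  · have := (abs_le.1 (hφabs x)).2
    rw [abs_of_nonneg hx] at this
    simp only [W]
    rw [abs_of_nonneg (by linarith)]
    linarith
  · have hi1 : Integrable (fun y => |x + y + R| + R) ν :=
      (((integrable_const x).add h1).add (integrable_const R)).abs.add (integrable_const R)
    have hi : Integrable (fun y => W (x + y)) ν := hi1.add ((hφint x).const_mul 2)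
    rw [← ofReal_integral_eq_lintegral_ofReal hi (Eventually.of_forall fun y => hW0 _)]
    refine ENNReal.ofReal_le_ofReal ?_
    have e : ∫ y, W (x + y) ∂ν = (x + R + 2 * H x) + R + 2 * ∫ y, φ (x + y) ∂ν := by
      simp only [W]
      rw [integral_add hi1 ((hφint x).const_mul 2), integral_add _ (integrable_const R), habs,
        integral_const_mul]
      · simp
      · exact (((integrable_const x).add h1).add (integrable_const R)).abs
    rw [e]
    have := hφsup x hx
    simp only [W]
    rw [abs_of_nonneg (by linarith)]
    linarith

/-! ### The killed walk: monotonicity and positive association -/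

/-- One step of the random walk with step law `ν`, killed outside `B`. -/
noncomputable def killedStep (ν : Measure ℝ) (B : Set ℝ) (g : ℝ → ℝ≥0∞) : ℝ → ℝ≥0∞ :=
  B.indicator fun x => ∫⁻ y, g (x + y) ∂ν

/-- The expectation of `g` at time `n` of the random walk killed on leaving `B`. -/
noncomputable def killedWalk (ν : Measure ℝ) (B : Set ℝ) (n : ℕ) (g : ℝ → ℝ≥0∞) : ℝ → ℝ≥0∞ :=
  (killedStep ν B)^[n] (B.indicator g)

section KilledWalk

variable {ν : Measure ℝ} {B : Set ℝ} {f g : ℝ → ℝ≥0∞}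

lemma killedWalk_zero : killedWalk ν B 0 g = B.indicator g := rfl

lemma killedWalk_succ (n : ℕ) :
    killedWalk ν B (n + 1) g = killedStep ν B (killedWalk ν B n g) :=
  Function.iterate_succ_apply' _ _ _

lemma killedWalk_succ' (n : ℕ) :
    killedWalk ν B (n + 1) g = killedWalk ν B n fun x => ∫⁻ y, B.indicator g (x + y) ∂ν :=
  Function.iterate_succ_apply _ _ _

lemma killedStep_mono (h : f ≤ g) : killedStep ν B f ≤ killedStep ν B g := fun _ =>
  Set.indicator_le_indicator (lintegral_mono fun _ => h _)

lemma killedWalk_mono (n : ℕ) (h : ∀ x ∈ B, f x ≤ g x) :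
    killedWalk ν B n f ≤ killedWalk ν B n g := by
  induction n with
  | zero =>
    intro x
    by_cases hx : x ∈ B <;> simp [killedWalk_zero, hx, h]
  | succ n ih => simpa only [killedWalk_succ] using killedStep_mono ih

/-- Iterating a superharmonic function decreases it. -/
lemma killedWalk_le (n : ℕ) (h : ∀ x ∈ B, ∫⁻ y, g (x + y) ∂ν ≤ g x) :
    killedWalk ν B n g ≤ g := by
  induction n with
  | zero => exact Set.indicator_le_self _ _
  | succ n ih =>
    intro x
    rw [killedWalk_succ, killedStep]
    by_cases hx : x ∈ B
    · rw [Set.indicator_of_mem hx]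
      exact (lintegral_mono fun y => ih (x + y)).trans (h x hx)
    · simp [hx]

lemma monotone_indicator_of_isUpperSet (hB : IsUpperSet B) (hg : Monotone g) :
    Monotone (B.indicator g) := by
  intro x y hxy
  by_cases hx : x ∈ B
  · simpa [hx, hB hxy hx] using hg hxy
  · simp [hx]

lemma monotone_killedWalk (hB : IsUpperSet B) (hg : Monotone g) (n : ℕ) :
    Monotone (killedWalk ν B n g) := by
  induction n with
  | zero => exact monotone_indicator_of_isUpperSet hB hg
  | succ n ih =>
    rw [killedWalk_succ]
    exact monotone_indicator_of_isUpperSet hB fun x y hxy =>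
      lintegral_mono fun z => ih (by linarith)

/-- The rearrangement inequality `(b - a) * (d - c) ≥ 0`, written without subtraction. -/
lemma ENNReal.mul_add_mul_le_mul_add_mul_of_le {a b c d : ℝ≥0∞} (hab : a ≤ b)
    (hcd : c ≤ d) : a * d + b * c ≤ a * c + b * d := by
  obtain ⟨p, rfl⟩ := exists_add_of_le hab
  obtain ⟨q, rfl⟩ := exists_add_of_le hcd
  calc a * (c + q) + (a + p) * c ≤ a * (c + q) + (a + p) * c + p * q := le_self_add
    _ = a * c + (a + p) * (c + q) := by ring

/-- Chebyshev's association inequality for monotone functions. -/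
lemma lintegral_mul_lintegral_le_of_monotone [IsProbabilityMeasure ν] (hf : Monotone f)
    (hg : Monotone g) : (∫⁻ x, f x ∂ν) * ∫⁻ x, g x ∂ν ≤ ∫⁻ x, f x * g x ∂ν := by
  have hfm := hf.measurable
  have hgm := hg.measurable
  have key : ∫⁻ x, ∫⁻ y, (f x * g y + f y * g x) ∂ν ∂ν ≤
      ∫⁻ x, ∫⁻ y, (f x * g x + f y * g y) ∂ν ∂ν := by
    refine lintegral_mono fun x => lintegral_mono fun y => ?_
    rcases le_total x y with h | h
    · exact ENNReal.mul_add_mul_le_mul_add_mul_of_le (hf h) (hg h)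
    · rw [add_comm, add_comm (f x * g x)]
      exact ENNReal.mul_add_mul_le_mul_add_mul_of_le (hf h) (hg h)
  have e1 : ∫⁻ x, ∫⁻ y, (f x * g y + f y * g x) ∂ν ∂ν =
      2 * ((∫⁻ x, f x ∂ν) * ∫⁻ x, g x ∂ν) := by
    have : ∀ x, ∫⁻ y, (f x * g y + f y * g x) ∂ν =
        f x * (∫⁻ y, g y ∂ν) + (∫⁻ y, f y ∂ν) * g x := fun x => by
      rw [lintegral_add_left (hgm.const_mul _), lintegral_const_mul _ hgm,
        lintegral_mul_const _ hfm]
    simp_rw [this]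
    rw [lintegral_add_left (hfm.mul_const _), lintegral_const_mul _ hgm,
      lintegral_mul_const _ hfm, two_mul]
  have e2 : ∫⁻ x, ∫⁻ y, (f x * g x + f y * g y) ∂ν ∂ν = 2 * ∫⁻ x, f x * g x ∂ν := by
    have : ∀ x, ∫⁻ y, (f x * g x + f y * g y) ∂ν = f x * g x + ∫⁻ y, f y * g y ∂ν := fun x => by
      rw [lintegral_add_left measurable_const]
      simp
    simp_rw [this]
    rw [lintegral_add_right _ measurable_const, two_mul]
    simp
  rw [e1, e2] at key
  exact (ENNReal.mul_le_mul_iff_right two_ne_zero ENNReal.ofNat_ne_top).1 key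

/-- Positive association: surviving in an upper set favours large values of the walk. -/
lemma killedWalk_one_mul_le [IsProbabilityMeasure ν] (hB : IsUpperSet B) (hf : Monotone f)
    (n : ℕ) (x : ℝ) :
    killedWalk ν B n 1 x * killedWalk ν Set.univ n f x ≤ killedWalk ν B n f x := by
  induction n generalizing x with
  | zero => by_cases hx : x ∈ B <;> simp [killedWalk_zero, hx]
  | succ n ih =>
    simp only [killedWalk_succ, killedStep, Set.indicator_univ]
    by_cases hx : x ∈ B
    · simp only [Set.indicator_of_mem hx]
      have hm : Monotone fun y : ℝ => x + y := fun a b h => by simpa using h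
      -- Both iterates are increasing in the position after the first step, so Chebyshev applies to
      -- that step; induction handles the rest.
      exact (lintegral_mul_lintegral_le_of_monotone
        ((monotone_killedWalk hB monotone_const n).comp hm)
        ((monotone_killedWalk isUpperSet_univ hf n).comp hm)).trans
        (lintegral_mono fun y => ih (x + y))
    · simp [hx]

/-! ### Survival probabilities as killed iterates -/

variable {Ω : Type*} [MeasurableSpace Ω] {μ : Measure Ω} {Z : ℕ → Ω → ℝ}

/-- The event that the walk with steps `Z` started at `u` stays in `B` up to time `n`. -/
def survival (Z : ℕ → Ω → ℝ) (B : Set ℝ) (u : ℝ) (n : ℕ) : Set Ω :=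
  {ω | ∀ k ≤ n, u + ∑ i ∈ Finset.range k, Z i ω ∈ B}

lemma measurableSet_survival (hZ : ∀ i, Measurable (Z i)) (hB : MeasurableSet B) (u : ℝ) (n : ℕ) :
    MeasurableSet (survival Z B u n) := by
  have : survival Z B u n = ⋂ k, ⋂ (_ : k ≤ n),
      (fun ω => u + ∑ i ∈ Finset.range k, Z i ω) ⁻¹' B := by
    ext; simp [survival]
  rw [this]
  refine MeasurableSet.iInter fun k => MeasurableSet.iInter fun _ => ?_
  exact (measurable_const.add (Finset.measurable_fun_sum _ fun i _ => hZ i)) hB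

lemma indepFun_survival_step (hZ : ∀ i, Measurable (Z i)) (hind : iIndepFun Z μ)
    (hB : MeasurableSet B) (u : ℝ) (n : ℕ) :
    IndepFun (fun ω => (∑ i ∈ Finset.range n, Z i ω,
      (survival Z B u n).indicator (1 : Ω → ℝ≥0∞) ω)) (Z n) μ := by
  have h := hind.indepFun_finset (Finset.range n) {n} (by simp) hZ
  -- Padding by zeros exhibits `S_n` and survival up to `n` as functions of the first `n` steps
  -- alone.
  let e : (Finset.range n → ℝ) → ℕ → ℝ := fun z i => if h : i ∈ Finset.range n then z ⟨i, h⟩ else 0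
  have he : ∀ i, Measurable fun z => e z i := by
    intro i
    by_cases h : i ∈ Finset.range n
    · simp only [e, h, dif_pos]
      exact measurable_pi_apply _
    · simp only [e, h, dif_neg, not_false_eq_true]
      exact measurable_const
  let φ : (Finset.range n → ℝ) → ℝ × ℝ≥0∞ := fun z => (∑ i ∈ Finset.range n, e z i,
    (survival (fun i z => e z i) B u n).indicator 1 z)
  have hφ : Measurable φ := (Finset.measurable_fun_sum _ fun i _ => he i).prodMk
    (measurable_one.indicator (measurableSet_survival he hB u n))
  have hev : Measurable fun z : (({n} : Finset ℕ) → ℝ) => z ⟨n, by simp⟩ := measurable_pi_apply _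
  have h2 := h.comp hφ hev
  refine h2.congr (Eventually.of_forall fun ω => ?_) .rfl
  have hsum : ∀ k ≤ n, ∑ i ∈ Finset.range k, e (fun i : Finset.range n => Z i ω) i =
      ∑ i ∈ Finset.range k, Z i ω := by
    intro k hk
    refine Finset.sum_congr rfl fun i hi => ?_
    have : i < n := (Finset.mem_range.1 hi).trans_le hk
    simp [e, this]
  have hmem : (fun i : Finset.range n => Z i ω) ∈ survival (fun i z => e z i) B u n ↔
      ω ∈ survival Z B u n := by
    refine forall₂_congr fun k hk => ?_
    rw [hsum k hk]
  refine Prod.ext (hsum n le_rfl) ?_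
  simp only [φ, Function.comp_apply]
  by_cases hω : ω ∈ survival Z B u n
  · simp [hω, hmem.2 hω]
  · simp [hω, mt hmem.1 hω]

/-- Identifies the analytic iterates with expectations over the walk. The last step, independent of
the past, is integrated out and absorbed into `g`, hence the induction over all `g`. -/
lemma setLIntegral_survival [IsProbabilityMeasure μ] (hZ : ∀ i, Measurable (Z i))
    (hind : iIndepFun Z μ) (hlaw : ∀ i, μ.map (Z i) = ν) (hB : MeasurableSet B) (u : ℝ) (n : ℕ)
    (hg : Measurable g) :
    ∫⁻ ω in survival Z B u n, g (u + ∑ i ∈ Finset.range n, Z i ω) ∂μ = killedWalk ν B n g u := by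
  have hνp : IsProbabilityMeasure ν := by
    rw [← hlaw 0]; exact Measure.isProbabilityMeasure_map (hZ 0).aemeasurable
  induction n generalizing g with
  | zero => by_cases hu : u ∈ B <;> simp [killedWalk_zero, survival, hu]
  | succ n ih =>
    have hgB : Measurable (B.indicator g) := hg.indicator hB
    have hKm : Measurable fun x => ∫⁻ y, B.indicator g (x + y) ∂ν :=
      Measurable.lintegral_prod_right' (f := fun p : ℝ × ℝ => B.indicator g (p.1 + p.2))
        (hgB.comp (measurable_fst.add measurable_snd))
    have hS : ∀ n, Measurable fun ω => ∑ i ∈ Finset.range n, Z i ω := fun n =>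
      Finset.measurable_fun_sum _ fun i _ => hZ i
    have hsn := measurableSet_survival hZ hB u n
    rw [killedWalk_succ', ← ih hKm, ← lintegral_indicator (measurableSet_survival hZ hB u _),
      ← lintegral_indicator hsn]
    have hY : Measurable fun ω => (∑ i ∈ Finset.range n, Z i ω,
        (survival Z B u n).indicator (1 : Ω → ℝ≥0∞) ω) :=
      (hS n).prodMk (measurable_one.indicator hsn)
    have hprod := (indepFun_iff_map_prod_eq_prod_map_map hY.aemeasurable
      (hZ n).aemeasurable).1 (indepFun_survival_step hZ hind hB u n)
    let F : (ℝ × ℝ≥0∞) × ℝ → ℝ≥0∞ := fun p => p.1.2 * B.indicator g (u + p.1.1 + p.2)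
    have hF : Measurable F := by
      refine measurable_fst.snd.mul (hgB.comp ?_)
      fun_prop
    calc _ = ∫⁻ ω, F ((∑ i ∈ Finset.range n, Z i ω,
            (survival Z B u n).indicator (1 : Ω → ℝ≥0∞) ω), Z n ω) ∂μ := by
          refine lintegral_congr fun ω => ?_
          have hiff : ω ∈ survival Z B u (n + 1) ↔ ω ∈ survival Z B u n ∧
              u + ∑ i ∈ Finset.range (n + 1), Z i ω ∈ B := by
            constructor
            · exact fun h => ⟨fun k hk => h k (by omega), h _ le_rfl⟩
            · rintro ⟨h1, h2⟩ k hk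
              rcases Nat.lt_or_ge n k with h | h
              · obtain rfl : k = n + 1 := by omega
                exact h2
              · exact h1 k h
          have e : u + ∑ i ∈ Finset.range n, Z i ω + Z n ω =
              u + ∑ i ∈ Finset.range (n + 1), Z i ω := by
            rw [Finset.sum_range_succ, add_assoc]
          simp only [F, e]
          by_cases h1 : ω ∈ survival Z B u n <;>
            by_cases h2 : u + ∑ i ∈ Finset.range (n + 1), Z i ω ∈ B <;>
            simp [hiff, h1, h2]
      _ = ∫⁻ p, ∫⁻ y, F (p, y) ∂ν ∂(μ.map fun ω => (∑ i ∈ Finset.range n, Z i ω,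
            (survival Z B u n).indicator (1 : Ω → ℝ≥0∞) ω)) := by
          rw [← lintegral_map hF (hY.prodMk (hZ n)), hprod, hlaw,
            lintegral_prod _ hF.aemeasurable]
      _ = _ := by
          rw [lintegral_map hF.lintegral_prod_right' hY]
          refine lintegral_congr fun ω => ?_
          simp only [F]
          rw [lintegral_const_mul _ (by fun_prop)]
          by_cases h1 : ω ∈ survival Z B u n <;> simp [h1]

/-! ### Growth of the mean absolute value -/

lemma one_sub_cos_le_abs (x : ℝ) : 1 - Real.cos x ≤ |x| := by
  have h1 := Real.one_sub_sq_div_two_le_cos (x := x)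
  have h2 := Real.neg_one_le_cos x
  rw [← sq_abs] at h1
  rcases le_total |x| 2 with h | h
  · nlinarith [abs_nonneg x]
  · linarith

/-- The mean absolute value dominates the deviation of the characteristic function from `1`. -/
lemma one_sub_re_charFun_le_integral_abs [IsProbabilityMeasure μ] {Y : Ω → ℝ}
    (hY : Integrable Y μ) :
    1 - (charFun (μ.map Y) 1).re ≤ ∫ ω, |Y ω| ∂μ := by
  have hYm := hY.aemeasurable
  have hcos : Integrable (fun ω => Real.cos (Y ω)) μ := by
    refine Integrable.mono' (integrable_const 1)
      (Real.measurable_cos.comp_aemeasurable hYm).aestronglyMeasurable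
      (Eventually.of_forall fun ω => Real.abs_cos_le_one _)
  have hre : (charFun (μ.map Y) 1).re = ∫ ω, Real.cos (Y ω) ∂μ := by
    rw [charFun_apply_real, integral_map hYm (by fun_prop), ← RCLike.re_eq_complex_re,
      ← integral_re]
    · refine integral_congr_ae (Eventually.of_forall fun ω => ?_)
      simp [Complex.exp_re]
    · refine Integrable.mono' (integrable_const 1) (by fun_prop)
        (Eventually.of_forall fun ω => ?_)
      simp [Complex.norm_exp]
  calc 1 - (charFun (μ.map Y) 1).re = ∫ ω, (1 - Real.cos (Y ω)) ∂μ := by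
        rw [hre, integral_sub (integrable_const _) hcos]; simp
    _ ≤ _ := integral_mono ((integrable_const _).sub hcos) hY.abs fun ω => one_sub_cos_le_abs _

/-- The mean absolute value of a centred random walk grows at least like `√n`. -/
lemma exists_mul_sqrt_le_integral_abs_sum [IsProbabilityMeasure μ]
    (hident : ∀ i, IdentDistrib (Z i) (Z 0) μ μ)
    (hind : iIndepFun Z μ) (h2 : MemLp (Z 0) 2 μ) (h0 : ∫ ω, Z 0 ω ∂μ = 0)
    (hv : 0 < Var[Z 0; μ]) :
    ∃ c : ℝ, 0 < c ∧ ∀ᶠ n : ℕ in atTop,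
      c * √n ≤ ∫ ω, |∑ i ∈ Finset.range n, Z i ω| ∂μ := by
  set v := Var[Z 0; μ] with hvdef
  have hsv : 0 < √v := Real.sqrt_pos.2 hv
  have hint : ∀ i, Integrable (Z i) μ := fun i =>
    (hident i).integrable_iff.2 (h2.integrable one_le_two)
  have hdiv : Measurable fun x : ℝ => x / √v := measurable_id.div_const _
  have hidY : ∀ i, IdentDistrib (fun ω => Z i ω / √v) (fun ω => Z 0 ω / √v) μ μ :=
    fun i => (hident i).comp hdiv
  have hindY : iIndepFun (fun i ω => Z i ω / √v) μ := hind.comp (fun _ x => x / √v) fun _ => hdiv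
  have hlim := tendsto_charFun_inv_sqrt_mul_pow (P := μ) (X := fun ω => Z 0 ω / √v)
    (hidY 0).aemeasurable_fst (by simp [integral_div, h0]) (by
      simp only [Pi.pow_apply, div_pow]
      rw [integral_div, Real.sq_sqrt hv.le, hvdef,
        variance_of_integral_eq_zero (hident 0).aemeasurable_fst h0]
      refine div_self ?_
      rw [← variance_of_integral_eq_zero (hident 0).aemeasurable_fst h0]
      exact hv.ne') 1
  have hexp : Complex.exp (-((1 : ℝ) : ℂ) ^ 2 / 2) = ((Real.exp (-1 / 2) : ℝ) : ℂ) := by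
    push_cast; norm_num
  rw [hexp] at hlim
  have hre := (Complex.continuous_re.tendsto _).comp hlim
  rw [Complex.ofReal_re] at hre
  have hlt : Real.exp (-1 / 2) < 1 := by rw [Real.exp_lt_one_iff]; norm_num
  -- The characteristic function of `S_n / √(n * v)` at `1` tends to `exp (-1 / 2)`, so its real
  -- part is eventually below `r < 1`.
  obtain ⟨r, hr1, hr2⟩ := exists_between hlt
  refine ⟨(1 - r) * √v, mul_pos (by linarith) hsv, ?_⟩
  filter_upwards [hre.eventually_lt_const hr1, eventually_gt_atTop 0] with n hn hn0
  have hsn : 0 < √(n : ℝ) := Real.sqrt_pos.2 (by exact_mod_cast hn0)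
  have hsum : Integrable (fun ω => ∑ i ∈ Finset.range n, Z i ω / √v) μ :=
    integrable_finsetSum _ fun i _ => (hint i).div_const _
  have hb := one_sub_re_charFun_le_integral_abs (hsum.const_mul (√n)⁻¹)
  rw [charFun_inv_sqrt_mul_sum hindY hidY] at hb
  simp only [Function.comp_apply] at hn
  have e : ∀ ω, |(√n)⁻¹ * ∑ i ∈ Finset.range n, Z i ω / √v| =
      (√n * √v)⁻¹ * |∑ i ∈ Finset.range n, Z i ω| := by
    intro ω
    rw [← Finset.sum_div, abs_mul, abs_div, abs_of_pos (inv_pos.2 hsn), abs_of_pos hsv]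
    field_simp
  rw [integral_congr_ae (Eventually.of_forall e)] at hb
  rw [integral_const_mul, le_inv_mul_iff₀ (by positivity)] at hb
  have hr : 1 - r ≤ 1 - ((charFun (μ.map fun ω => Z 0 ω / √v) ((√n)⁻¹ * 1)) ^ n).re := by
    linarith
  calc (1 - r) * √v * √n = (1 - r) * (√n * √v) := by ring
    _ ≤ √n * √v * (1 - ((charFun (μ.map fun ω => Z 0 ω / √v) ((√n)⁻¹ * 1)) ^ n).re) := by
        rw [mul_comm]
        gcongr
    _ ≤ _ := hb

/-! ### The survival estimate -/

/-- The probability that a centred random walk stays above `-u` up to time `n` is of order at most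
`(u + 1) / √n`. -/
lemma exists_sqrt_mul_measure_survival_le [IsProbabilityMeasure μ]
    (hZ : ∀ i, Measurable (Z i))
    (hident : ∀ i, IdentDistrib (Z i) (Z 0) μ μ)
    (hind : iIndepFun Z μ) (h2 : MemLp (Z 0) 2 μ) (h0 : ∫ ω, Z 0 ω ∂μ = 0)
    (hv : 0 < Var[Z 0; μ]) :
    ∃ C : ℝ≥0, ∀ᶠ n : ℕ in atTop, ∀ u : ℝ≥0,
      (NNReal.sqrt n : ℝ≥0∞) * μ (survival Z (Set.Ici 0) u n) ≤ C * (u + 1) := by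
  obtain ⟨c, hc, hev⟩ := exists_mul_sqrt_le_integral_abs_sum hident hind h2 h0 hv
  set ν := μ.map (Z 0) with hν
  have hνp : IsProbabilityMeasure ν := Measure.isProbabilityMeasure_map (hZ 0).aemeasurable
  have hlaw : ∀ i, μ.map (Z i) = ν := fun i => (hident i).map_eq
  obtain ⟨R, V, hR, hV1, hV2, hV3⟩ := exists_superharmonic (ν := ν)
    ((memLp_map_measure_iff aestronglyMeasurable_id (hZ 0).aemeasurable).2 h2)
    (by rwa [hν, integral_map (hZ 0).aemeasurable (by fun_prop)])
    (by
      rw [integral_map (hZ 0).aemeasurable (by fun_prop),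
        ← variance_of_integral_eq_zero (hZ 0).aemeasurable h0]
      exact hv)
  have hint : ∀ i, Integrable (Z i) μ := fun i =>
    (hident i).integrable_iff.2 (h2.integrable one_le_two)
  have hmono : Monotone fun x : ℝ => ENNReal.ofReal x := ENNReal.ofReal_mono
  refine ⟨Real.toNNReal ((2 + 2 * R) * (2 / c)), hev.mono fun n hn u => ?_⟩
  have hu : (0 : ℝ) ≤ u := u.2
  have hS : Integrable (fun ω => ∑ i ∈ Finset.range n, Z i ω) μ :=
    integrable_finsetSum _ fun i _ => hint i
  have hS0 : ∫ ω, ∑ i ∈ Finset.range n, Z i ω ∂μ = 0 := by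
    rw [integral_finsetSum _ fun i _ => hint i]
    exact Finset.sum_eq_zero fun i _ => by rw [(hident i).integral_eq, h0]
  have hlow : ENNReal.ofReal (c / 2 * √n) ≤
      killedWalk ν Set.univ n (fun x => ENNReal.ofReal x) u := by
    -- Lowering the starting point to `0` makes the bound uniform in `u`.
    refine le_trans ?_ (monotone_killedWalk isUpperSet_univ hmono n hu)
    rw [← setLIntegral_survival hZ hind hlaw MeasurableSet.univ 0 n hmono.measurable]
    have : survival Z Set.univ 0 n = Set.univ := by ext; simp [survival]
    rw [this, Measure.restrict_univ]
    have e : ∀ ω, ENNReal.ofReal (0 + ∑ i ∈ Finset.range n, Z i ω) =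
        ENNReal.ofReal (max (∑ i ∈ Finset.range n, Z i ω) 0) := by
      intro ω; rw [zero_add, ENNReal.ofReal_max]; simp
    simp_rw [e]
    rw [← ofReal_integral_eq_lintegral_ofReal hS.pos_part
      (Eventually.of_forall fun ω => le_max_right _ _)]
    refine ENNReal.ofReal_le_ofReal ?_
    have e2 : ∀ ω, max (∑ i ∈ Finset.range n, Z i ω) 0 =
        (∑ i ∈ Finset.range n, Z i ω + |∑ i ∈ Finset.range n, Z i ω|) / 2 := fun ω => by
      
      rcases le_total 0 (∑ i ∈ Finset.range n, Z i ω) with h | h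
      · rw [max_eq_left h, abs_of_nonneg h]; ring
      · rw [max_eq_right h, abs_of_nonpos h]; ring
    simp_rw [e2]
    rw [integral_div, integral_add hS hS.abs, hS0]
    linarith
  have hQ : μ (survival Z (Set.Ici 0) u n) = killedWalk ν (Set.Ici 0) n 1 u := by
    rw [← setLIntegral_survival hZ hind hlaw measurableSet_Ici u n measurable_one]
    simp
  have hmain : ENNReal.ofReal (c / 2 * √n) * μ (survival Z (Set.Ici 0) u n) ≤
      ENNReal.ofReal (2 * u + 2 * R) := by
    rw [hQ, mul_comm]
    calc _ ≤ killedWalk ν (Set.Ici 0) n 1 u *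
          killedWalk ν Set.univ n (fun x => ENNReal.ofReal x) u := by gcongr
      _ ≤ killedWalk ν (Set.Ici 0) n (fun x => ENNReal.ofReal x) u :=
          killedWalk_one_mul_le (isUpperSet_Ici 0) hmono n u
      _ ≤ killedWalk ν (Set.Ici 0) n V u := killedWalk_mono n hV1 u
      _ ≤ V u := killedWalk_le n hV3 u
      _ ≤ _ := hV2 u hu
  have e1 : (NNReal.sqrt n : ℝ≥0∞) = ENNReal.ofReal (2 / c) * ENNReal.ofReal (c / 2 * √n) := by
    rw [← ENNReal.ofReal_mul (by positivity)]
    have : 2 / c * (c / 2 * √(n : ℝ)) = ((NNReal.sqrt n : ℝ≥0) : ℝ) := by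
      rw [Real.coe_sqrt]; field_simp; simp
    rw [this, ENNReal.ofReal_coe_nnreal]
  calc _ = ENNReal.ofReal (2 / c) * (ENNReal.ofReal (c / 2 * √n) *
        μ (survival Z (Set.Ici 0) u n)) := by rw [e1, mul_assoc]
    _ ≤ ENNReal.ofReal (2 / c) * ENNReal.ofReal (2 * u + 2 * R) := by gcongr
    _ ≤ ENNReal.ofReal ((2 + 2 * R) * (2 / c) * (u + 1)) := by
        rw [← ENNReal.ofReal_mul (by positivity)]
        refine ENNReal.ofReal_le_ofReal ?_
        have : 2 * (u : ℝ) + 2 * R ≤ (2 + 2 * R) * (u + 1) := by nlinarith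
        have h3 := mul_le_mul_of_nonneg_left this (by positivity : 0 ≤ 2 / c)
        linarith
    _ = _ := by
        rw [ENNReal.ofReal_mul (by positivity), ENNReal.ofReal_add hu zero_le_one]
        simp [ENNReal.ofReal]

end KilledWalk

/-! ### From the integer skeleton to the Lévy process -/

theorem mainTheorem4 {Ω : Type*} [MeasurableSpace Ω] (μ : Measure Ω) [IsProbabilityMeasure μ]
    (X : ℝ≥0 → Ω → ℝ) (hX : IsLevyProcess X μ)
    (hvar : MemLp (X 1) 2 μ) (hmean : ∫ ω, X 1 ω ∂μ = 0) (hnondeg : 0 < Var[X 1; μ]) :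
    limsup (fun t : ℝ≥0 => (NNReal.sqrt t : ℝ≥0∞) *
      ⨆ u : ℝ≥0, (1 / ((u : ℝ≥0∞) + 1)) * μ {ω | ((-(u : ℝ) : ℝ) : EReal) ≤ runningInf X t ω})
      atTop < ∞ := by
  let Z : ℕ → Ω → ℝ := fun i ω => X (i + 1 : ℕ) ω - X (i : ℕ) ω
  have hZ : ∀ i, Measurable (Z i) := fun i => (hX.measurable _).sub (hX.measurable _)
  have hid1 : ∀ i, IdentDistrib (Z i) (X 1) μ μ := fun i => by
    have := hX.stationary_increments (i : ℕ) 1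
    simpa [Z] using this
  have hind : iIndepFun Z μ :=
    hX.indep_increments.nat (t := fun i : ℕ => (i : ℝ≥0)) Nat.mono_cast
  obtain ⟨C, hC⟩ := exists_sqrt_mul_measure_survival_le hZ
    (fun i => (hid1 i).trans (hid1 0).symm) hind ((hid1 0).memLp_iff.2 hvar)
    ((hid1 0).integral_eq.trans hmean) (by rwa [(hid1 0).variance_eq])
  have hfloor : Tendsto (fun t : ℝ≥0 => ⌊t⌋₊) atTop atTop := tendsto_nat_floor_atTop
  refine lt_of_le_of_lt (limsup_le_of_le (by isBoundedDefault) (a := 2 * (C : ℝ≥0∞)) ?_)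
    (ENNReal.mul_lt_top ENNReal.ofNat_lt_top ENNReal.coe_lt_top)
  filter_upwards [hfloor.eventually hC, eventually_ge_atTop 1] with t ht ht1
  rw [ENNReal.mul_iSup]
  refine iSup_le fun u => ?_
  have hle : μ {ω | ((-(u : ℝ) : ℝ) : EReal) ≤ runningInf X t ω} ≤
      μ (survival Z (Set.Ici 0) u ⌊t⌋₊) := by
    refine measure_mono_ae ?_
    filter_upwards [hX.zero_ae] with ω hω0 hω k hk
    have hsum : ∑ i ∈ Finset.range k, Z i ω = X (k : ℕ) ω := by
      rw [Finset.sum_range_sub (fun i : ℕ => X (i : ℝ≥0) ω)]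
      simp [hω0]
    have hkt : (k : ℝ≥0) ≤ t := (Nat.cast_le.2 hk).trans (Nat.floor_le zero_le)
    have h1 : ((-(u : ℝ) : ℝ) : EReal) ≤ (X (k : ℕ) ω : EReal) :=
      le_trans hω (iInf₂_le (k : ℝ≥0) ⟨zero_le, hkt⟩)
    have h2 := EReal.coe_le_coe_iff.1 h1
    rw [hsum, Set.mem_Ici]
    linarith
  have hsq : (NNReal.sqrt t : ℝ≥0∞) ≤ 2 * (NNReal.sqrt (⌊t⌋₊ : ℝ≥0) : ℝ≥0∞) := by
    have h1 : (1 : ℝ≥0) ≤ (⌊t⌋₊ : ℝ≥0) := by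
      exact_mod_cast Nat.one_le_floor_iff t |>.2 ht1
    -- For `t ≥ 1`, `t ≤ 4 * ⌊t⌋₊`; this is the factor `2` in the final bound `2 * C`.
    have h2 : t ≤ 2 ^ 2 * (⌊t⌋₊ : ℝ≥0) := by
      have := (Nat.lt_floor_add_one t).le
      calc t ≤ (⌊t⌋₊ : ℝ≥0) + 1 := this
        _ ≤ (⌊t⌋₊ : ℝ≥0) + 3 * ⌊t⌋₊ := by
          gcongr
          exact h1.trans (le_mul_of_one_le_left zero_le (by norm_num))
        _ = _ := by ring
    have h3 := NNReal.sqrt_le_sqrt.2 h2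
    rw [NNReal.sqrt_mul, NNReal.sqrt_sq] at h3
    exact_mod_cast h3
  have hu0 : (u : ℝ≥0∞) + 1 ≠ 0 := by simp
  have hu1 : (u : ℝ≥0∞) + 1 ≠ ∞ := by simp
  calc _ ≤ 2 * (NNReal.sqrt (⌊t⌋₊ : ℝ≥0) : ℝ≥0∞) *
        (1 / ((u : ℝ≥0∞) + 1) * μ (survival Z (Set.Ici 0) u ⌊t⌋₊)) := by gcongr
    _ = 2 * (1 / ((u : ℝ≥0∞) + 1)) * ((NNReal.sqrt (⌊t⌋₊ : ℝ≥0) : ℝ≥0∞) *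
        μ (survival Z (Set.Ici 0) u ⌊t⌋₊)) := by ring
    _ ≤ 2 * (1 / ((u : ℝ≥0∞) + 1)) * (C * (u + 1)) := by
        exact mul_le_mul_right (ht u) _
    _ = 2 * C * (((u : ℝ≥0∞) + 1)⁻¹ * (u + 1)) := by rw [one_div]; ring
    _ = 2 * C := by rw [ENNReal.inv_mul_cancel hu0 hu1, mul_one]
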